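/- Let $M$ be a closed manifold, that is, a compact connected differentiable ($C^1$) manifold without boundary, equipped with any continuous Riemannian metric $g$ and with any distance $d$ inducing its topology (for example the Riemannian distance). Let $\mathrm{Leb}$ be the Lebesgue measure of $M$, i.e. the Riemannian volume of $g$ normalized to total mass $1$. Let $f:M\to M$ be differentiable (at every point; the derivative is not assumed to be continuous) and volume expanding: there are constants $K>0$ and $\lambda>1$ such that $$|\det Df^k(x)|\ge K\lambda^k\qquad\text{for all }x\in M,\ k\in\mathbb N=\{0,1,2,\dots\},$$ where the absolute value of the determinant of $Df^k(x):T_xM\to T_{f^k(x)}M$ is taken with respect to $g$. Then $f$ is positively $\mathrm{Leb}$-expansive: $\mathrm{Leb}$ is a Borel probability measure, $f$ is continuous, and there is $\delta>0$ such that for every $x\in M$ $$\mathrm{Leb}\bigl(\{y\in M: d(f^i(x),f^i(y))\le\delta\ \text{ for all } i\in\mathbb N\}\bigr)=0 .$$ -/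

import Mathlib

open Set Filter Topology MeasureTheory Bundle
open scoped Manifold ContDiff ENNReal

noncomputable section

section Riemannian

variable {n : ℕ} {M : Type*} [TopologicalSpace M] [ChartedSpace (EuclideanSpace ℝ (Fin n)) M]
  [IsManifold (𝓡 n) 1 M]

/-- Gram determinant `det (g_p(v_i, v_j))` of `n` tangent vectors at `p`: the square of the volume
of the parallelepiped that they span, measured with the Riemannian metric `g`. -/
def gramDet (g : ContinuousRiemannianMetric (EuclideanSpace ℝ (Fin n))
      (fun p : M => TangentSpace (𝓡 n) p))
    (p : M) (v : Fin n → TangentSpace (𝓡 n) p) : ℝ :=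
  (Matrix.of fun i j => g.inner p (v i) (v j)).det

/-- The coordinate vectors of the tangent space at `p` (a basis of it). -/
def tangentStdBasis (p : M) : Module.Basis (Fin n) ℝ (TangentSpace (𝓡 n) p) :=
  (EuclideanSpace.basisFun (Fin n) ℝ).toBasis

/-- The absolute value of the determinant of a linear map `L : T_p M → T_q M` between tangent
spaces, with respect to the Riemannian metric `g`: the factor by which `L` multiplies the volume of
parallelepipeds. It is computed on the coordinate basis of `T_p M`; by
`absDet_eq_of_orthonormal` it equals `|det A|` for the matrix `A` of `L` in any
orthonormal bases of `T_p M` and `T_q M`. -/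
def absDet (g : ContinuousRiemannianMetric (EuclideanSpace ℝ (Fin n))
      (fun p : M => TangentSpace (𝓡 n) p))
    {p q : M} (L : TangentSpace (𝓡 n) p →L[ℝ] TangentSpace (𝓡 n) q) : ℝ :=
  √(gramDet g q (fun i => L (tangentStdBasis p i)) / gramDet g p (fun i => tangentStdBasis p i))

/-- Gram determinants in terms of an orthonormal basis. -/
theorem gramDet_eq_sq (g : ContinuousRiemannianMetric (EuclideanSpace ℝ (Fin n))
      (fun p : M => TangentSpace (𝓡 n) p))
    (p : M) (b : Module.Basis (Fin n) ℝ (TangentSpace (𝓡 n) p))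
    (hb : ∀ i j, g.inner p (b i) (b j) = if i = j then 1 else 0)
    (v : Fin n → TangentSpace (𝓡 n) p) :
    gramDet g p v = (b.toMatrix v).det ^ 2 := by
  have key : (Matrix.of fun i j => g.inner p (v i) (v j))
      = (b.toMatrix v).transpose * b.toMatrix v := by
    ext i j
    have hi : v i = ∑ k, b.toMatrix v k i • b k := (b.sum_toMatrix_smul_self v i).symm
    have hj : v j = ∑ k, b.toMatrix v k j • b k := (b.sum_toMatrix_smul_self v j).symm
    rw [Matrix.of_apply, Matrix.mul_apply]
    have hj' : ∀ k, g.inner p (b k) (v j) = b.toMatrix v k j := by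
      intro k
      conv_lhs => rw [hj]
      rw [map_sum]
      simp only [map_smul, smul_eq_mul, hb]
      simp
    conv_lhs => arg 1; rw [hi]
    rw [map_sum, _root_.sum_apply]
    simp only [map_smul, _root_.smul_apply, smul_eq_mul, hj',
      Matrix.transpose_apply]
  rw [gramDet, key, Matrix.det_mul, Matrix.det_transpose, sq]

theorem absDet_eq_of_orthonormal (g : ContinuousRiemannianMetric (EuclideanSpace ℝ (Fin n))
      (fun p : M => TangentSpace (𝓡 n) p))
    {p q : M} (b : Module.Basis (Fin n) ℝ (TangentSpace (𝓡 n) p))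
    (hb : ∀ i j, g.inner p (b i) (b j) = if i = j then 1 else 0)
    (c : Module.Basis (Fin n) ℝ (TangentSpace (𝓡 n) q))
    (hc : ∀ i j, g.inner q (c i) (c j) = if i = j then 1 else 0)
    (L : TangentSpace (𝓡 n) p →L[ℝ] TangentSpace (𝓡 n) q) :
    absDet g L = |(LinearMap.toMatrix b c (L : TangentSpace (𝓡 n) p →ₗ[ℝ] _)).det| := by
  have h1 : c.toMatrix (fun i => L (tangentStdBasis p i))
      = LinearMap.toMatrix b c (L : TangentSpace (𝓡 n) p →ₗ[ℝ] _)
        * b.toMatrix (tangentStdBasis p) := by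
    rw [linearMap_toMatrix_mul_basis_toMatrix]
    ext i j
    simp [LinearMap.toMatrix_apply, Module.Basis.toMatrix_apply]
  have h2 : (b.toMatrix (tangentStdBasis p)).det ≠ 0 := by
    have := b.toMatrix_mul_toMatrix_flip (tangentStdBasis p)
    intro h0
    have h3 := congrArg Matrix.det this
    rw [Matrix.det_mul, h0, Matrix.det_one] at h3
    simp at h3
  rw [absDet, gramDet_eq_sq g q c hc, gramDet_eq_sq g p b hb, h1, Matrix.det_mul, mul_pow,
    mul_div_assoc, div_self (pow_ne_zero 2 h2), mul_one, Real.sqrt_sq_eq_abs]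

/-- The Riemannian volume density `√(det (g_{ij}))` in the coordinates of the chart at `x₀`, where
`g_{ij} = g(∂_i, ∂_j)` and `∂_1, …, ∂_n` are the coordinate vector fields. -/
def volumeDensity (g : ContinuousRiemannianMetric (EuclideanSpace ℝ (Fin n))
      (fun p : M => TangentSpace (𝓡 n) p))
    (x₀ : M) (y : EuclideanSpace ℝ (Fin n)) : ℝ :=
  √(gramDet g ((chartAt (EuclideanSpace ℝ (Fin n)) x₀).symm y) (fun i =>
    mfderiv (𝓡 n) (𝓡 n) (chartAt (EuclideanSpace ℝ (Fin n)) x₀).symm y (tangentStdBasis y i)))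

/-- A map `f : M → M` is volume expanding if it is differentiable and there are `K > 0` and `λ > 1`
with `|det (Df^k(x))| ≥ K λ^k` for all `x ∈ M` and `k ∈ ℕ`. -/
def IsVolumeExpanding (g : ContinuousRiemannianMetric (EuclideanSpace ℝ (Fin n))
      (fun p : M => TangentSpace (𝓡 n) p)) (f : M → M) : Prop :=
  MDifferentiable (𝓡 n) (𝓡 n) f ∧
    ∃ K > (0 : ℝ), ∃ l > (1 : ℝ), ∀ (x : M) (k : ℕ),
      K * l ^ k ≤ absDet g (mfderiv (𝓡 n) (𝓡 n) f^[k] x)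

variable [MeasurableSpace M]

/-- The Riemannian volume on the domain of the chart at `x₀` (extended by zero to `M`): the measure
`√(det (g_{ij})) dy_1 ⋯ dy_n` on the range of the chart, transported to `M`. -/
def chartVolume (g : ContinuousRiemannianMetric (EuclideanSpace ℝ (Fin n))
      (fun p : M => TangentSpace (𝓡 n) p)) (x₀ : M) : Measure M :=
  ((volume.restrict (chartAt (EuclideanSpace ℝ (Fin n)) x₀).target).withDensity
    (fun y => ENNReal.ofReal (volumeDensity g x₀ y))).map
      (chartAt (EuclideanSpace ℝ (Fin n)) x₀).symm

/-- The chart volume of a Borel set is `∫ √(det (g_{ij})) dy` over its coordinate image. -/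
theorem chartVolume_apply [BorelSpace M]
    (g : ContinuousRiemannianMetric (EuclideanSpace ℝ (Fin n))
      (fun p : M => TangentSpace (𝓡 n) p)) (x₀ : M) {A : Set M} (hA : MeasurableSet A) :
    chartVolume g x₀ A =
      ∫⁻ y in (chartAt (EuclideanSpace ℝ (Fin n)) x₀) ''
          (A ∩ (chartAt (EuclideanSpace ℝ (Fin n)) x₀).source),
        ENNReal.ofReal (volumeDensity g x₀ y) := by
  set φ := chartAt (EuclideanSpace ℝ (Fin n)) x₀ with hφ
  have hm : AEMeasurable φ.symm (volume.restrict φ.target) :=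
    φ.symm.continuousOn.aemeasurable φ.open_target.measurableSet
  have him : φ '' (A ∩ φ.source) = φ.target ∩ φ.symm ⁻¹' A := by
    rw [inter_comm]; exact φ.image_source_inter_eq' A
  have hms : MeasurableSet (φ.target ∩ φ.symm ⁻¹' A) := by
    rw [← Subtype.image_preimage_coe]
    have h : Measurable (φ.target.domRestrict φ.symm) :=
      (continuousOn_iff_continuous_domRestrict.1 φ.symm.continuousOn).measurable
    exact φ.open_target.measurableSet.subtype_image (h hA)
  rw [chartVolume, Measure.map_apply_of_aemeasurable
    (hm.mono_ac (withDensity_absolutelyContinuous _ _)) hA, him,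
    ← restrict_withDensity φ.open_target.measurableSet,
    Measure.restrict_apply' φ.open_target.measurableSet, inter_comm, withDensity_apply _ hms]

/-- The Riemannian volume measure of `(M, g)`: the least measure on `M` which dominates the
Riemannian volume of every chart domain. Since the chart volumes agree on overlaps (change of
variables), this is the measure that coincides with `chartVolume g x₀` on the domain of
the chart at `x₀`, for every `x₀`. -/
def riemannianVolume (g : ContinuousRiemannianMetric (EuclideanSpace ℝ (Fin n))
      (fun p : M => TangentSpace (𝓡 n) p)) : Measure M :=
  ⨆ x₀ : M, chartVolume g x₀

/-- The (normalized) Lebesgue measure of a closed Riemannian manifold. -/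
def lebesgueMeasure (g : ContinuousRiemannianMetric (EuclideanSpace ℝ (Fin n))
      (fun p : M => TangentSpace (𝓡 n) p)) : Measure M :=
  (riemannianVolume g univ)⁻¹ • riemannianVolume g

end Riemannian

section Expansive

variable {X : Type*} [MetricSpace X]

/-- `Φ_δ(x)`: the points whose forward orbit stays within distance `δ` of the orbit of `x`. -/
def forwardTube (f : X → X) (δ : ℝ) (x : X) : Set X :=
  {y | ∀ i : ℕ, dist (f^[i] x) (f^[i] y) ≤ δ}

/-- `f` is positively `μ`-expansive: `μ` is a Borel probability measure, `f` is continuous, and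
there is `δ > 0` such that `μ(Φ_δ(x)) = 0` for all `x`. -/
def IsPositivelyExpansive [MeasurableSpace X] (μ : Measure X) (f : X → X) : Prop :=
  IsProbabilityMeasure μ ∧ Continuous f ∧ ∃ δ > (0 : ℝ), ∀ x : X, μ (forwardTube f δ x) = 0

end Expansive

end

/-! Suppose `f` is injective at a uniform scale `δ`: two points of a common closed `δ`-ball with the
same image coincide. If the orbits of `y` and `z` both stay `δ`-close to that of `x`, then an
equality `f^[k] y = f^[k] z` can be pulled back one step at a time, so every iterate is injective on
the tube `A = forwardTube f δ x`. The change of variables formula, which needs only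
differentiability and injectivity, gives `K * l ^ k * vol A ≤ vol (f^[k] '' A) ≤ vol M`. The right
side is finite and `k` is arbitrary, so `vol A = 0`.

By compactness the uniform scale follows from local injectivity. Since `Df` need not be continuous,
the usual inverse function theorem is not available; the substitute is
`exists_nhds_injOn_of_hasFDerivAt`. Invertible derivatives make `f` open, since a minimum of `‖f y -
p‖ ^ 2` at an interior point must be a zero. Call a point singular if `f` is injective on none of
its neighbourhoods. By Baire, if singular points exist, then on some ball all distances to singular
points are expanded by one constant. Inside it, start from two points with the same image, and move
one of them straight towards the nearest singular point `x₁`. The second preimage persists along the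
way. Near `x₁`, however, `f` is almost affine at the scale of the distance to `x₁` and locally
injective at that scale, and a covering space argument (`injOn_ball_of_norm_sub_le`) excludes a
second preimage. -/

noncomputable section

/-! ### Openness from invertible derivatives, and injectivity by lifting -/

section LocalInjectivity

variable {E : Type*} [NormedAddCommGroup E]

/-- A map with invertible derivative at a point expands distances from this point by a definite
factor, locally. -/
theorem HasFDerivAt.exists_eventually_dist_le [NormedSpace ℝ E] {f : E → E} {A : E ≃L[ℝ] E} {x : E}
    (hf : HasFDerivAt f (A : E →L[ℝ] E) x) :
    ∃ C > (0 : ℝ), ∀ᶠ y in 𝓝 x, dist y x ≤ C * dist (f y) (f x) := by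
  set a := ‖(A.symm : E →L[ℝ] E)‖ + 1
  have ha : 0 < a := by positivity
  refine ⟨2 * a, by positivity, ?_⟩
  -- After multiplication by `a`, this error is half of `‖y - x‖` and is absorbed on the left; hence
  -- the constant `2 * a`.
  have := hf.isLittleO.def (c := (2 * a)⁻¹) (by positivity)
  filter_upwards [this] with y hy
  rw [dist_eq_norm, dist_eq_norm]
  have h1 : ‖y - x‖ ≤ a * ‖A (y - x)‖ := by
    calc ‖y - x‖ = ‖(A.symm : E →L[ℝ] E) (A (y - x))‖ := by simp
      _ ≤ ‖(A.symm : E →L[ℝ] E)‖ * ‖A (y - x)‖ := ContinuousLinearMap.le_opNorm _ _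
      _ ≤ a * ‖A (y - x)‖ := by gcongr; simp [a]
  have h2 : ‖A (y - x)‖ ≤ ‖f y - f x‖ + (2 * a)⁻¹ * ‖y - x‖ := by
    calc ‖A (y - x)‖ = ‖(f y - f x) - (f y - f x - A (y - x))‖ := by congr 1; abel
      _ ≤ ‖f y - f x‖ + ‖f y - f x - A (y - x)‖ := norm_sub_le _ _
      _ ≤ _ := by gcongr; exact hy
  have h3 : a * ‖A (y - x)‖ ≤ a * (‖f y - f x‖ + (2 * a)⁻¹ * ‖y - x‖) := by gcongr
  have h4 : a * ((2 * a)⁻¹ * ‖y - x‖) = ‖y - x‖ / 2 := by field_simp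
  rw [mul_add, h4] at h3
  linarith

/-- A map which is differentiable near a point, with invertible derivatives, is open and
continuous at this point. -/
theorem map_nhds_eq_of_eventually_hasFDerivAt [InnerProductSpace ℝ E] [FiniteDimensional ℝ E]
    {f : E → E} {f' : E → E ≃L[ℝ] E} {x : E}
    (hf : ∀ᶠ y in 𝓝 x, HasFDerivAt f (f' y : E →L[ℝ] E) y) :
    map f (𝓝 x) = 𝓝 (f x) := by
  apply le_antisymm hf.self_of_nhds.continuousAt
  intro s hs
  obtain ⟨C, hC, hCx⟩ := hf.self_of_nhds.exists_eventually_dist_le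
  obtain ⟨r, hr, hrs⟩ := Metric.nhds_basis_closedBall.eventually_iff.1
    ((mem_map.1 hs : f ⁻¹' s ∈ 𝓝 x) |> fun h => hCx.and (hf.and h))
  refine mem_of_superset (Metric.ball_mem_nhds (f x) (ε := r / (2 * C)) (by positivity)) ?_
  intro p hp
  have hcont : ContinuousOn f (Metric.closedBall x r) := fun y hy =>
    (hrs hy).2.1.continuousAt.continuousWithinAt
  -- The minimizer of the distance from `f y` to `p` is interior, because expansion at `x` keeps the
  -- image of the sphere away from `p`. There the differential of the square vanishes, and
  -- invertibility of `f' y` forces `f y = p`.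
  obtain ⟨y, hy, hmin⟩ := (isCompact_closedBall x r).exists_isMinOn
    (f := fun y => ‖f y - p‖ ^ 2) ⟨x, Metric.mem_closedBall_self hr.le⟩
    ((hcont.sub continuousOn_const).norm.pow 2)
  have hle : ‖f y - p‖ ≤ ‖f x - p‖ := by
    have := hmin (Metric.mem_closedBall_self hr.le)
    exact le_of_sq_le_sq this (norm_nonneg _)
  have hpx : ‖f x - p‖ < r / (2 * C) := by
    rw [← dist_eq_norm, dist_comm]; exact hp
  have hyr : dist y x < r := by
    have h1 := (hrs hy).1
    have h2 : dist (f y) (f x) < r / C := by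
      calc dist (f y) (f x) ≤ dist (f y) p + dist p (f x) := dist_triangle _ _ _
        _ = ‖f y - p‖ + ‖f x - p‖ := by rw [dist_eq_norm, dist_comm p, dist_eq_norm]
        _ < r / (2 * C) + r / (2 * C) := by linarith
        _ = r / C := by field_simp; ring
    calc dist y x ≤ C * dist (f y) (f x) := h1
      _ < C * (r / C) := by gcongr
      _ = r := by field_simp
  have hloc : IsLocalMin (fun y => ‖f y - p‖ ^ 2) y :=
    hmin.isLocalMin (Metric.closedBall_mem_nhds_of_mem hyr)
  have hd := ((hrs hy).2.1.sub_const p).norm_sq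
  have h0 := hloc.hasFDerivAt_eq_zero hd
  have h1 := congrArg (fun L : E →L[ℝ] ℝ => L ((f' y).symm (f y - p))) h0
  have : f y = p := by
    simpa [← inner_sub_left, sub_eq_zero] using h1
  rw [← this]
  exact (hrs hy).2.2

/-- A locally injective open map which is close to a translation on a ball is injective on a
smaller ball. -/
theorem injOn_ball_of_norm_sub_le [NormedSpace ℝ E] [FiniteDimensional ℝ E]
    {f : E → E} {z : E} {r : ℝ} (hr : 0 < r)
    (hinj : ∀ y ∈ Metric.closedBall z r, ∃ U ∈ 𝓝 y, InjOn f U)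
    (hmap : ∀ y ∈ Metric.closedBall z r, map f (𝓝 y) = 𝓝 (f y))
    (happ : ∀ y ∈ Metric.closedBall z r, ‖f y - f z - (y - z)‖ ≤ r / 10) :
    InjOn f (Metric.ball z (r / 10)) := by
  set K := Metric.closedBall z r
  set D := Metric.ball (f z) (r / 2)
  have hcont : ContinuousOn f K := fun y hy =>
    ContinuousAt.continuousWithinAt (hmap y hy).le
  let p : K → E := fun y => f y
  have hp : Continuous p := continuousOn_iff_continuous_domRestrict.1 hcont
  have : CompactSpace K := isCompact_iff_compactSpace.1 (isCompact_closedBall z r)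
  -- Points of `K` over `D` lie in the open ball, as `r / 2 + r / 10 < r`, so the boundary of `K`
  -- does not interfere. Compactness of `K` then turns the local homeomorphism into a covering over
  -- `D`.
  have hloc : IsLocalHomeomorphOn p (p ⁻¹' D) := by
    rw [isLocalHomeomorphOn_iff_isOpenEmbedding_restrict]
    intro x hx
    have hxr : (x : E) ∈ Metric.ball z r := by
      have h1 := happ x x.2
      have h2 : ‖f x - f z‖ < r / 2 := by rw [← dist_eq_norm]; exact hx
      rw [Metric.mem_ball, dist_eq_norm]
      calc ‖(x : E) - z‖ = ‖(f x - f z) - (f x - f z - (x - z))‖ := by congr 1; abel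
        _ ≤ ‖f x - f z‖ + ‖f x - f z - (x - z)‖ := norm_sub_le _ _
        _ < r := by linarith
    obtain ⟨U, hU, hUinj⟩ := hinj x x.2
    obtain ⟨O, hO, hOo, hxO⟩ := mem_nhds_iff.1 (inter_mem hU (Metric.isOpen_ball.mem_nhds hxr))
    have hV : Subtype.val ⁻¹' O ∈ 𝓝 x :=
      continuous_subtype_val.continuousAt.preimage_mem_nhds (hOo.mem_nhds hxO)
    refine ⟨_, hV, .of_continuous_injective_isOpenMap (hp.comp continuous_subtype_val) ?_ ?_⟩
    · intro v w hvw
      exact Subtype.ext (Subtype.ext (hUinj (hO v.2).1 (hO w.2).1 hvw))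
    · rw [isOpenMap_iff_nhds_le]
      intro v
      have e1 : map Subtype.val (𝓝 v) = 𝓝 v.1 :=
        map_nhds_subtype_coe_eq_nhds v.2
          ((hOo.preimage continuous_subtype_val).mem_nhds v.2)
      have e2 : map Subtype.val (𝓝 v.1) = 𝓝 v.1.1 :=
        map_nhds_subtype_coe_eq_nhds v.1.2
          (mem_of_superset (Metric.isOpen_ball.mem_nhds (hO v.2).2) Metric.ball_subset_closedBall)
      have : (Subtype.val ⁻¹' O).domRestrict p = f ∘ Subtype.val ∘ Subtype.val := rfl
      rw [this, ← map_map, ← map_map, e1, e2, hmap _ v.1.2]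
      rfl
  have hcov : IsCoveringMapOn p D := .of_isLocalHomeomorphOn hp hloc
  have hsub : Metric.ball z (r / 10) ⊆ K :=
    (Metric.ball_subset_ball (by linarith)).trans Metric.ball_subset_closedBall
  have hfD : ∀ y ∈ Metric.ball z (r / 10), f y ∈ D := by
    intro y hy
    have h1 := happ y (hsub hy)
    rw [Metric.mem_ball, dist_eq_norm] at hy ⊢
    calc ‖f y - f z‖ = ‖(f y - f z - (y - z)) + (y - z)‖ := by congr 1; abel
      _ ≤ ‖f y - f z - (y - z)‖ + ‖y - z‖ := norm_add_le _ _
      _ < r / 2 := by linarith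
  have conv : ∀ (c : E) {s : ℝ}, 0 < s → SimplyConnectedSpace (Metric.ball c s) ∧
      LocallyPathConnectedSpace (Metric.ball c s) := by
    intro c s hs
    have := (convex_ball c s).contractibleSpace ⟨c, Metric.mem_ball_self hs⟩
    exact ⟨inferInstance, Metric.isOpen_ball.locallyPathConnectedSpace⟩
  obtain ⟨i1, i2⟩ := conv (f z) (s := r / 2) (by positivity)
  obtain ⟨i3, i4⟩ := conv z (s := r / 10) (by positivity)
  intro a ha b hb hab
  -- `F` is the section of the covering over the simply connected `D` that passes through `a`. On
  -- the small ball, `F ∘ f` and the inclusion both lift `f` and agree at `a`, so `F` is a left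
  -- inverse of `f` there.
  obtain ⟨F, ⟨hFa, hF⟩, -⟩ := hcov.existsUnique_continuousMap_lifts (A := D)
    ⟨Subtype.val, continuous_subtype_val⟩ (a₀ := ⟨f a, hfD a ha⟩) (e₀ := ⟨a, hsub ha⟩) rfl
    (fun x => x.2)
  have hcb : Continuous fun x : Metric.ball z (r / 10) => f x :=
    continuousOn_iff_continuous_domRestrict.1 (hcont.mono hsub)
  obtain ⟨G, -, hG⟩ := hcov.existsUnique_continuousMap_lifts (A := Metric.ball z (r / 10))
    ⟨fun x => f x, hcb⟩ (a₀ := ⟨a, ha⟩) (e₀ := ⟨a, hsub ha⟩) rfl (fun x => hfD x x.2)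
  have e1 := hG ⟨fun x => ⟨x, hsub x.2⟩, by fun_prop⟩ ⟨rfl, rfl⟩
  have e2 := hG (F.comp ⟨fun x => ⟨f x, hfD x x.2⟩, hcb.subtype_mk _⟩) ⟨hFa, by
    funext x
    exact congrFun hF ⟨f x, hfD x x.2⟩⟩
  have key : ∀ x (hx : x ∈ Metric.ball z (r / 10)), (F ⟨f x, hfD x hx⟩ : E) = x := by
    intro x hx
    exact congrArg (fun H : C(Metric.ball z (r / 10), K) => (H ⟨x, hx⟩ : E)) (e2.trans e1.symm)
  rw [← key a ha, ← key b hb]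
  simp only [hab]

end LocalInjectivity

/-! ### Inverse function theorem without continuity of the derivative -/

section LocalInjectivity

variable {E : Type*} [NormedAddCommGroup E]

/-- The set of points where a map is locally injective is open. -/
theorem isOpen_setOf_exists_nhds_injOn {X Y : Type*} [TopologicalSpace X] (f : X → Y) :
    IsOpen {x | ∃ U ∈ 𝓝 x, InjOn f U} := by
  rw [isOpen_iff_mem_nhds]
  rintro x ⟨U, hU, hi⟩
  exact (eventually_mem_nhds_iff.2 hU).mono fun y hy => ⟨U, hy, hi⟩

/-- Let `h` have derivative the identity at `x`. For `v` close to `x` such that `h` is an open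
continuous and locally injective map around `v`, at the scale of `dist v x`, the only preimage `w`
of `h v` for which `dist w x` is controlled by `dist (h w) (h x)` is `v` itself. -/
theorem HasFDerivAt.eventually_eq_of_locally_injective [NormedSpace ℝ E]
    [FiniteDimensional ℝ E] {h : E → E} {x : E} {C : ℝ} (hC : 0 < C)
    (hx : HasFDerivAt h (ContinuousLinearMap.id ℝ E) x) :
    ∀ᶠ v in 𝓝 x, ∀ w, v ≠ x → dist w x ≤ C * dist (h w) (h x) →
      (∀ y ∈ Metric.closedBall v (dist v x / 2), ∃ U ∈ 𝓝 y, InjOn h U) →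
      (∀ y ∈ Metric.closedBall v (dist v x / 2), map h (𝓝 y) = 𝓝 (h y)) →
      h w = h v → w = v := by
  -- With `r = dist v x`, this makes the linearization errors at `v` and `w` add up to at most `r /
  -- 50`, and the error on the ball of radius `r / 2` about `v` at most `r / 20`, as
  -- `injOn_ball_of_norm_sub_le` requires.
  set ε := (50 * (2 * C + 1))⁻¹ with hε
  have hε0 : 0 < ε := by positivity
  have hε1 : ε * (50 * (2 * C + 1)) = 1 := inv_mul_cancel₀ (by positivity)
  have hε2 : 50 * ε ≤ 1 := by nlinarith [mul_pos hε0 hC]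
  obtain ⟨δ, hδ, happ⟩ := Metric.eventually_nhds_iff.1 (hx.isLittleO.def hε0)
  replace happ : ∀ y, dist y x < δ → ‖h y - h x - (y - x)‖ ≤ ε * dist y x := by
    intro y hy
    simpa [dist_eq_norm] using happ hy
  refine Metric.eventually_nhds_iff.2 ⟨δ / (2 * C + 2), by positivity, ?_⟩
  intro v hv w hvx hw hinj hmap heq
  set r := dist v x with hr
  have hr0 : 0 < r := dist_pos.2 hvx
  have hrδ : r * (2 * C + 2) < δ := (lt_div_iff₀ (by positivity)).1 hv
  have hCr : 0 < C * r := by positivity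
  have hva := happ v (by nlinarith)
  have hhv : dist (h v) (h x) ≤ 2 * r := by
    rw [dist_eq_norm]
    calc ‖h v - h x‖ = ‖(h v - h x - (v - x)) + (v - x)‖ := by congr 1; abel
      _ ≤ ‖h v - h x - (v - x)‖ + ‖v - x‖ := norm_add_le _ _
      _ ≤ ε * r + r := by rw [← dist_eq_norm v x]; gcongr
      _ ≤ 2 * r := by nlinarith
  have hwr : dist w x ≤ 2 * C * r := by
    rw [heq] at hw
    nlinarith
  have hwa := happ w (by nlinarith)
  -- As `h w = h v`, the difference `w - v` is a difference of two linearization errors.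
  have hwv : dist w v < r / 2 / 10 := by
    rw [dist_eq_norm]
    calc ‖w - v‖ = ‖(h v - h x - (v - x)) - (h w - h x - (w - x))‖ := by
          rw [heq]; congr 1; abel
      _ ≤ ‖h v - h x - (v - x)‖ + ‖h w - h x - (w - x)‖ := norm_sub_le _ _
      _ ≤ ε * r + ε * (2 * C * r) := by gcongr; exact hwa.trans (by gcongr)
      _ = (ε * (50 * (2 * C + 1))) * (r / 50) := by ring
      _ < r / 2 / 10 := by rw [hε1]; linarith
  have hball : InjOn h (Metric.ball v (r / 2 / 10)) := by
    refine injOn_ball_of_norm_sub_le (by positivity) hinj hmap fun y hy => ?_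
    have hyx : dist y x ≤ 3 / 2 * r := by
      have := dist_triangle y v x
      rw [Metric.mem_closedBall] at hy
      linarith
    have hya := happ y (by nlinarith)
    calc ‖h y - h v - (y - v)‖ = ‖(h y - h x - (y - x)) - (h v - h x - (v - x))‖ := by
          congr 1; abel
      _ ≤ ‖h y - h x - (y - x)‖ + ‖h v - h x - (v - x)‖ := norm_sub_le _ _
      _ ≤ ε * (3 / 2 * r) + ε * r := by gcongr; exact hya.trans (by gcongr)
      _ ≤ r / 2 / 10 := by nlinarith
  exact hball hwv (Metric.mem_ball_self (by positivity)) heq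

/-- Along a path of points where `f` is locally injective, having a second preimage in a compact
set `K` of the image persists, as long as the second preimages stay in the interior of `K`. -/
theorem Icc_subset_setOf_exists_ne_of_map_nhds_eq {X Y : Type*} [MetricSpace X]
    [TopologicalSpace Y] [T2Space Y] {f : X → Y} {K : Set X} (hK : IsCompact K)
    (hmap : ∀ z ∈ K, map f (𝓝 z) = 𝓝 (f z)) {γ : ℝ → X} (hγ : Continuous γ) {a b : ℝ}
    (hγK : ∀ t ∈ Icc a b, γ t ∈ K) (hγi : ∀ t ∈ Icc a b, ∃ U ∈ 𝓝 (γ t), InjOn f U)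
    (hint : ∀ t ∈ Icc a b, ∀ w ∈ K, f w = f (γ t) → K ∈ 𝓝 w)
    (ha : ∃ w ∈ K, w ≠ γ a ∧ f w = f (γ a)) :
    Icc a b ⊆ {t | ∃ w ∈ K, w ≠ γ t ∧ f w = f (γ t)} := by
  -- Connectedness of the interval. The condition is closed because a limit of second preimages
  -- cannot merge with `γ t`, where `f` is locally injective. It is open because `f` is open at `w`.
  refine IsClosed.Icc_subset_of_forall_mem_nhdsWithin (IsSeqClosed.isClosed ?_) ha ?_
  · intro u t hu hut
    have ht : t ∈ Icc a b := isClosed_Icc.mem_of_tendsto hut (.of_forall fun k => (hu k).2)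
    choose w hwK hwne hwf using fun k => (hu k).1
    obtain ⟨w', hw'K, φ, hφ, hw'⟩ := hK.tendsto_subseq hwK
    have hγt : Tendsto (fun k => γ (u (φ k))) atTop (𝓝 (γ t)) :=
      (hγ.tendsto t).comp (hut.comp hφ.tendsto_atTop)
    refine ⟨⟨w', hw'K, ?_, ?_⟩, ht⟩
    · rintro rfl
      obtain ⟨U, hU, hUi⟩ := hγi t ht
      obtain ⟨k, hk1, hk2⟩ := ((hw'.eventually hU).and (hγt.eventually hU)).exists
      exact hwne (φ k) (hUi hk1 hk2 (hwf (φ k)))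
    · refine tendsto_nhds_unique (Tendsto.comp (hmap w' hw'K).le hw') ?_
      have : f ∘ (w ∘ φ) = fun k => f (γ (u (φ k))) := funext fun k => hwf (φ k)
      rw [this]
      exact Tendsto.comp (hmap (γ t) (hγK t ht)).le hγt
  · rintro t ⟨⟨w, hwK, hwne, hwf⟩, ht⟩
    have ht' := Ico_subset_Icc_self ht
    obtain ⟨U, V, hU, hV, hwU, hγV, hUV⟩ := t2_separation hwne
    have h1 : f '' (U ∩ K) ∈ 𝓝 (f (γ t)) := by
      rw [← hwf, ← hmap w hwK]
      exact image_mem_map (inter_mem (hU.mem_nhds hwU) (hint t ht' w hwK hwf))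
    have h2 : Tendsto (f ∘ γ) (𝓝 t) (𝓝 (f (γ t))) :=
      Tendsto.comp (hmap (γ t) (hγK t ht')).le (hγ.tendsto t)
    apply mem_nhdsWithin_of_mem_nhds
    filter_upwards [h2 h1, (hγ.tendsto t) (hV.mem_nhds hγV)] with s hs1 hs2
    obtain ⟨v, ⟨hvU, hvK⟩, hv⟩ := hs1
    exact ⟨v, hvK, fun h => hUV.ne_of_mem hvU hs2 h, hv⟩

/-- If distances to the points where a map with invertible derivatives is not locally injective
are expanded, uniformly on a ball, then the map is injective near the center of the ball. -/
theorem exists_nhds_injOn_of_expanding_at_singular [InnerProductSpace ℝ E] [FiniteDimensional ℝ E]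
    {f : E → E} {f' : E → E ≃L[ℝ] E} {x₀ : E} {ρ C : ℝ} (hρ : 0 < ρ) (hC : 0 < C)
    (hf : ∀ᶠ z in 𝓝ˢ (Metric.closedBall x₀ ρ), HasFDerivAt f (f' z : E →L[ℝ] E) z)
    (hexp : ∀ x ∈ Metric.closedBall x₀ ρ, (¬ ∃ U ∈ 𝓝 x, InjOn f U) →
      ∀ y ∈ Metric.closedBall x₀ ρ, dist y x ≤ C * dist (f y) (f x)) :
    ∃ U ∈ 𝓝 x₀, InjOn f U := by
  by_contra hx₀
  set K := Metric.closedBall x₀ ρ with hK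
  have hx₀K : x₀ ∈ K := Metric.mem_closedBall_self hρ.le
  set G : Set E := {x | ∃ U ∈ 𝓝 x, InjOn f U} with hG
  have hGo : IsOpen G := isOpen_setOf_exists_nhds_injOn f
  have hmap : ∀ z ∈ K, map f (𝓝 z) = 𝓝 (f z) := fun z hz =>
    map_nhds_eq_of_eventually_hasFDerivAt (f' := f') (eventually_nhdsSet_iff_forall.1 hf z hz)
  have hd : ∀ z ∈ K, HasFDerivAt f (f' z : E →L[ℝ] E) z := fun z hz =>
    (eventually_nhdsSet_iff_forall.1 hf z hz).self_of_nhds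
  -- Since `x₀` is singular, expansion at `x₀` places every preimage in `K` of a value within `ρ /
  -- C` of `f x₀` in the open ball. This keeps second preimages off the boundary of `K`.
  obtain ⟨η₀, hη₀, hη₀f⟩ := Metric.continuousAt_iff.1 (hd x₀ hx₀K).continuousAt (ρ / C)
    (by positivity)
  set η := min (η₀ / 2) (ρ / 2) with hη
  have hη0 : 0 < η := by positivity
  have hη1 : 2 * η ≤ η₀ := by linarith [min_le_left (η₀ / 2) (ρ / 2)]
  have hη2 : 2 * η ≤ ρ := by linarith [min_le_right (η₀ / 2) (ρ / 2)]
  refine hx₀ ⟨Metric.ball x₀ η, Metric.ball_mem_nhds _ hη0, ?_⟩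
  intro y hy y' hy' hyy'
  by_contra hne
  have hηK : Metric.ball x₀ η ⊆ K := (Metric.ball_subset_ball (by linarith)).trans
    Metric.ball_subset_closedBall
  have hyG : y ∈ G := by
    by_contra hyG
    have := hexp y (hηK hy) hyG y' (hηK hy')
    rw [hyy', dist_self, mul_zero] at this
    exact hne (dist_le_zero.1 this).symm
  -- With `x₁` a nearest singular point of `K`, the open ball of radius `d` about `y` is free of
  -- singular points, and the segment `γ` crosses it to reach `x₁`.
  obtain ⟨x₁, ⟨hx₁K, hx₁G⟩, hd₁⟩ := IsCompact.exists_infDist_eq_dist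
    ((isCompact_closedBall x₀ ρ).inter_right hGo.isClosed_compl) (Exists.intro x₀ ⟨hx₀K, hx₀⟩) y
  set d := dist y x₁ with hdd
  have hd0 : 0 < d := dist_pos.2 (fun h => hx₁G (h ▸ hyG))
  have hdη : d < η := by
    rw [← hd₁]
    exact (Metric.infDist_le_dist_of_mem (s := K ∩ Gᶜ) ⟨hx₀K, hx₀⟩).trans_lt hy
  have hB : Metric.closedBall y d ⊆ Metric.ball x₀ (2 * η) := by
    intro z hz
    have := dist_triangle z y x₀
    rw [Metric.mem_closedBall] at hz
    rw [Metric.mem_ball] at hy ⊢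
    linarith
  have hBK : Metric.closedBall y d ⊆ K := hB.trans
    ((Metric.ball_subset_ball hη2).trans Metric.ball_subset_closedBall)
  have hBG : Metric.ball y d ⊆ G := by
    intro z hz
    by_contra hzG
    have : Metric.infDist y (K ∩ Gᶜ) ≤ dist y z :=
      Metric.infDist_le_dist_of_mem ⟨hBK (Metric.ball_subset_closedBall hz), hzG⟩
    rw [hd₁, dist_comm] at this
    exact absurd hz (not_lt.2 this)
  let γ : ℝ → E := fun t => AffineMap.lineMap y x₁ t
  have hγc : Continuous γ := AffineMap.lineMap_continuous
  have hγy : ∀ t, 0 ≤ t → dist (γ t) y = t * d := by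
    intro t ht
    simp [γ, dist_lineMap_left, abs_of_nonneg ht, d]
  have hγx : ∀ t, t ≤ 1 → dist (γ t) x₁ = (1 - t) * d := by
    intro t ht
    simp [γ, dist_lineMap_right, abs_of_nonneg (sub_nonneg.2 ht), d]
  have hγB : ∀ t, 0 ≤ t → t < 1 → γ t ∈ Metric.ball y d := by
    intro t ht ht1
    rw [Metric.mem_ball, hγy t ht]
    nlinarith
  set P : Set ℝ := {t | ∃ w ∈ K, w ≠ γ t ∧ f w = f (γ t)} with hP
  have hPall : ∀ b, b < 1 → Icc 0 b ⊆ P := by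
    intro b hb
    refine Icc_subset_setOf_exists_ne_of_map_nhds_eq (isCompact_closedBall x₀ ρ) hmap hγc
      (fun t ht => hBK (Metric.ball_subset_closedBall (hγB t ht.1 (ht.2.trans_lt hb))))
      (fun t ht => hBG (hγB t ht.1 (ht.2.trans_lt hb))) ?_
      ⟨y', hηK hy', by simpa [γ] using Ne.symm hne, by simp [γ, hyy']⟩
    intro t ht w hw hwf
    have h1 : dist (f w) (f x₀) < ρ / C := by
      rw [hwf]
      exact hη₀f ((hB (Metric.ball_subset_closedBall
        (hγB t ht.1 (ht.2.trans_lt hb)))).trans_le hη1)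
    have h2 : dist w x₀ < ρ := by
      calc dist w x₀ ≤ C * dist (f w) (f x₀) := hexp x₀ hx₀K hx₀ w hw
        _ < C * (ρ / C) := by gcongr
        _ = ρ := by field_simp
    exact Metric.closedBall_mem_nhds_of_mem h2
  -- Composition with the inverse of `A` normalizes the derivative at `x₁` to the identity and
  -- changes the expansion constant by a factor `‖A‖ + 1`.
  set A := f' x₁
  let h : E → E := fun z => A.symm (f z)
  have hinj' : ∀ z ∈ G, ∃ U ∈ 𝓝 z, InjOn h U := by
    rintro z ⟨U, hU, hi⟩
    exact ⟨U, hU, fun a ha b hb hab => hi ha hb (A.symm.injective hab)⟩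
  have hmap' : ∀ z ∈ K, map h (𝓝 z) = 𝓝 (h z) := by
    intro z hz
    have : h = A.symm ∘ f := rfl
    rw [this, ← map_map, hmap z hz]
    exact A.symm.toHomeomorph.map_nhds_eq (f z)
  have hder : HasFDerivAt h (ContinuousLinearMap.id ℝ E) x₁ := by
    have := (A.symm : E →L[ℝ] E).hasFDerivAt.comp x₁ (hd x₁ hx₁K)
    have hid : (A.symm : E →L[ℝ] E) ∘L (f' x₁ : E →L[ℝ] E) = ContinuousLinearMap.id ℝ E := by
      ext v
      simp [A]
    rwa [hid] at this
  set C' := C * (‖(A : E →L[ℝ] E)‖ + 1) with hC'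
  have hexp' : ∀ w ∈ K, dist w x₁ ≤ C' * dist (h w) (h x₁) := by
    intro w hw
    calc dist w x₁ ≤ C * dist (f w) (f x₁) := hexp x₁ hx₁K hx₁G w hw
      _ = C * ‖(A : E →L[ℝ] E) (h w - h x₁)‖ := by simp [h, dist_eq_norm]
      _ ≤ C * ((‖(A : E →L[ℝ] E)‖ + 1) * ‖h w - h x₁‖) := by
        gcongr
        refine (ContinuousLinearMap.le_opNorm _ _).trans ?_
        gcongr
        linarith
      _ = C' * dist (h w) (h x₁) := by rw [dist_eq_norm]; ring
  have hev := hder.eventually_eq_of_locally_injective (C := C') (by positivity)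
  have hγ1 : Tendsto γ (𝓝[<] 1) (𝓝 x₁) := by
    have := hγc.continuousAt (x := (1 : ℝ))
    have h1 : γ 1 = x₁ := by simp [γ]
    rw [ContinuousAt, h1] at this
    exact this.mono_left nhdsWithin_le_nhds
  obtain ⟨t, ht, ht0, ht1⟩ := ((hγ1.eventually hev).and
    ((eventually_nhdsWithin_of_eventually_nhds (lt_mem_nhds one_pos)).and
      (self_mem_nhdsWithin))).exists
  obtain ⟨w, hwK, hwne, hwf⟩ := hPall t ht1 ⟨ht0.le, le_rfl⟩
  -- The radii satisfy `t * d + (1 - t) * d / 2 < d`, so the ball at the scale of the distance to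
  -- `x₁` consists of regular points.
  have hsub : Metric.closedBall (γ t) (dist (γ t) x₁ / 2) ⊆ Metric.ball y d := by
    intro z hz
    have := dist_triangle z (γ t) y
    rw [Metric.mem_closedBall, hγx t (le_of_lt ht1)] at hz
    rw [hγy t ht0.le] at this
    rw [Metric.mem_ball]
    have : 0 < (1 - t) * d := mul_pos (sub_pos.2 ht1) hd0
    linarith
  refine hwne (ht w ?_ (hexp' w hwK) (fun z hz => hinj' z (hBG (hsub hz)))
    (fun z hz => hmap' z (hBK (Metric.ball_subset_closedBall (hsub hz)))) ?_)
  · rintro hγ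
    exact hx₁G (hγ ▸ hBG (hγB t ht0.le ht1))
  · simp only [h, hwf]

/-- Inverse function theorem for everywhere differentiable maps: a map whose derivative exists and
is invertible at every point of an open set is locally injective there. -/
theorem exists_nhds_injOn_of_hasFDerivAt [InnerProductSpace ℝ E] [FiniteDimensional ℝ E]
    {f : E → E} {f' : E → E ≃L[ℝ] E} {Ω : Set E} (hΩ : IsOpen Ω)
    (hf : ∀ x ∈ Ω, HasFDerivAt f (f' x : E →L[ℝ] E) x) {x : E} (hx : x ∈ Ω) :
    ∃ U ∈ 𝓝 x, InjOn f U := by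
  by_contra hxG
  set G : Set E := {x | ∃ U ∈ 𝓝 x, InjOn f U} with hG
  have hGo : IsOpen G := isOpen_setOf_exists_nhds_injOn f
  -- Baire's theorem will be applied to the singular set itself, which is locally closed.
  have hlc : LocallyCompactSpace (Ω ∩ Gᶜ : Set E) :=
    (hΩ.isLocallyClosed.inter hGo.isClosed_compl.isLocallyClosed).locallyCompactSpace
  have : Nonempty (Ω ∩ Gᶜ : Set E) := ⟨⟨x, hx, hxG⟩⟩
  let S : ℕ → Set (Ω ∩ Gᶜ : Set E) := fun m => {x | ∀ y ∈ Ω, dist y x < 1 / (m + 1 : ℝ) →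
    dist y x ≤ (m + 1 : ℝ) * dist (f y) (f x)}
  have hfc : Continuous fun x : (Ω ∩ Gᶜ : Set E) => f x :=
    continuousOn_iff_continuous_domRestrict.1 fun z hz =>
      (hf z hz.1).continuousAt.continuousWithinAt
  have hSc : ∀ m, IsClosed (S m) := by
    intro m
    have : S m = ⋂ y ∈ Ω, {x : (Ω ∩ Gᶜ : Set E) | 1 / (m + 1 : ℝ) ≤ dist y x} ∪
        {x | dist y x ≤ (m + 1 : ℝ) * dist (f y) (f x)} := by
      ext z
      simp only [S, mem_ofPred_eq, mem_iInter, mem_union]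
      refine forall₂_congr fun y _ => ?_
      rw [imp_iff_not_or, not_lt]
    rw [this]
    refine isClosed_biInter fun y _ => IsClosed.union ?_ ?_
    · exact isClosed_le continuous_const (by fun_prop)
    · exact isClosed_le (by fun_prop) (continuous_const.mul (continuous_const.dist hfc))
  have hSu : ⋃ m, S m = univ := by
    refine eq_univ_of_forall fun z => mem_iUnion.2 ?_
    obtain ⟨C, hC, hz⟩ := (hf z z.2.1).exists_eventually_dist_le
    obtain ⟨δ, hδ, hz⟩ := Metric.eventually_nhds_iff.1 hz
    obtain ⟨m, hm⟩ := exists_nat_gt (max C (1 / δ))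
    refine ⟨m, fun y hy hyz => ?_⟩
    have hm1 : C ≤ m + 1 := by linarith [le_max_left C (1 / δ)]
    have hm2 : 1 / (m + 1 : ℝ) ≤ δ := by
      rw [one_div_le (by positivity) hδ]
      linarith [le_max_right C (1 / δ)]
    calc dist y z ≤ C * dist (f y) (f z) := hz (hyz.trans_le hm2)
      _ ≤ _ := by gcongr
  obtain ⟨m, x₀, hx₀⟩ := nonempty_interior_of_iUnion_of_closed hSc hSu
  obtain ⟨η, hη, hηS⟩ := Metric.mem_nhds_iff.1 (mem_interior_iff_mem_nhds.1 hx₀)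
  obtain ⟨ρ₀, hρ₀, hρ₀Ω⟩ := Metric.isOpen_iff.1 hΩ x₀ x₀.2.1
  -- The three bounds keep the ball in `Ω`, put its singular points in `S m`, and keep any two of
  -- its points closer than `1 / (m + 1)`.
  set ρ := min (ρ₀ / 2) (min (η / 2) (1 / (m + 1 : ℝ) / 3)) with hρ
  have hm : 0 < 1 / (m + 1 : ℝ) := by positivity
  have hρ0 : 0 < ρ := by positivity
  have hρ1 : ρ ≤ ρ₀ / 2 := min_le_left _ _
  have hρ2 : ρ ≤ η / 2 := (min_le_right _ _).trans (min_le_left _ _)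
  have hρ3 : ρ ≤ 1 / (m + 1 : ℝ) / 3 := (min_le_right _ _).trans (min_le_right _ _)
  have hKΩ : Metric.closedBall (x₀ : E) ρ ⊆ Ω :=
    (Metric.closedBall_subset_ball (by linarith)).trans hρ₀Ω
  refine x₀.2.2 (exists_nhds_injOn_of_expanding_at_singular (f' := f') (C := m + 1) hρ0
    (by positivity) ?_ ?_)
  · exact eventually_nhdsSet_iff_forall.2 fun z hz =>
      Filter.mem_of_superset (hΩ.mem_nhds (hKΩ hz)) hf
  · intro z hz hzG y hy
    have hzS : (⟨z, hKΩ hz, hzG⟩ : (Ω ∩ Gᶜ : Set E)) ∈ S m := by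
      apply hηS
      rw [Metric.mem_ball, Subtype.dist_eq]
      rw [Metric.mem_closedBall] at hz
      exact hz.trans_lt (by linarith)
    refine hzS y (hKΩ hy) ?_
    rw [Metric.mem_closedBall] at hz hy
    have := dist_triangle_right y z x₀
    change dist y z < _
    linarith

end LocalInjectivity

/-! ### Determinants and volume densities in charts -/

section Riemannian

variable {n : ℕ} {M : Type*} [TopologicalSpace M] [ChartedSpace (EuclideanSpace ℝ (Fin n)) M]

/-- The determinant, in coordinate bases, of a linear map between tangent spaces. -/
def tangentDet {N : Type*} [TopologicalSpace N] [ChartedSpace (EuclideanSpace ℝ (Fin n)) N]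
    {p : M} {q : N} (L : TangentSpace (𝓡 n) p →L[ℝ] TangentSpace (𝓡 n) q) : ℝ :=
  ContinuousLinearMap.det
    (show EuclideanSpace ℝ (Fin n) →L[ℝ] EuclideanSpace ℝ (Fin n) from L)

theorem ContinuousLinearMap.det_comp {V : Type*} [AddCommGroup V] [TopologicalSpace V] [Module ℝ V]
    (A B : V →L[ℝ] V) : (A ∘L B).det = A.det * B.det :=
  LinearMap.det_comp _ _

variable [IsManifold (𝓡 n) 1 M]

/-- If `B` is the matrix of `L` and `G` the Gram matrix of the coordinate basis, the Gram matrix of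
the images is `Bᵀ * G * B`. Every tangent space is the model space by definition, so `L` may also
stand for a map between different tangent spaces. -/
theorem gramDet_linearMap (g : ContinuousRiemannianMetric (EuclideanSpace ℝ (Fin n))
      (fun p : M => TangentSpace (𝓡 n) p)) (p : M)
    (L : EuclideanSpace ℝ (Fin n) →L[ℝ] EuclideanSpace ℝ (Fin n)) :
    gramDet g p (fun i => L ((EuclideanSpace.basisFun (Fin n) ℝ).toBasis i)) =
      L.det ^ 2 * gramDet g p (fun i => tangentStdBasis p i) := by
  set b : Module.Basis (Fin n) ℝ (TangentSpace (𝓡 n) p) := tangentStdBasis p with hb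
  let v : Fin n → TangentSpace (𝓡 n) p := fun i => L ((EuclideanSpace.basisFun (Fin n) ℝ).toBasis i)
  have key : (Matrix.of fun i j => g.inner p (v i) (v j))
      = (b.toMatrix v).transpose * (Matrix.of fun i j => g.inner p (b i) (b j)) *
        b.toMatrix v := by
    ext i j
    have hi : v i = ∑ k, b.toMatrix v k i • b k := (b.sum_toMatrix_smul_self v i).symm
    have hj : v j = ∑ k, b.toMatrix v k j • b k := (b.sum_toMatrix_smul_self v j).symm
    rw [Matrix.of_apply, Matrix.mul_apply]
    conv_lhs => rw [hj, map_sum]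
    refine Finset.sum_congr rfl fun k _ => ?_
    rw [map_smul, smul_eq_mul, mul_comm]
    congr 1
    rw [Matrix.mul_apply]
    conv_lhs => rw [hi]
    rw [map_sum, _root_.sum_apply]
    simp
  have hdet : (b.toMatrix v).det = L.det := by
    have : b.toMatrix v = LinearMap.toMatrix (EuclideanSpace.basisFun (Fin n) ℝ).toBasis
        (EuclideanSpace.basisFun (Fin n) ℝ).toBasis (L : _ →ₗ[ℝ] _) := by
      ext i j
      rw [LinearMap.toMatrix_apply, Module.Basis.toMatrix_apply]
      rfl
    rw [this, LinearMap.det_toMatrix]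
  change (Matrix.of fun i j => g.inner p (v i) (v j)).det = _
  rw [key, Matrix.det_mul, Matrix.det_mul, Matrix.det_transpose, hdet, gramDet]
  ring

theorem gramDet_tangentStdBasis_pos (g : ContinuousRiemannianMetric (EuclideanSpace ℝ (Fin n))
      (fun p : M => TangentSpace (𝓡 n) p)) (p : M) :
    0 < gramDet g p (fun i => tangentStdBasis p i) := by
  refine (Matrix.PosDef.of_dotProduct_mulVec_pos ?_ ?_).det_pos
  · ext i j
    simp [g.symm p (tangentStdBasis p j)]
  · intro x hx
    set v := ∑ i, x i • tangentStdBasis p i with hv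
    have hv0 : v ≠ 0 := by
      intro h
      refine hx (funext fun i => ?_)
      exact Fintype.linearIndependent_iff.1 (tangentStdBasis p).linearIndependent x h i
    have := g.pos p v hv0
    have e : g.inner p v v = star x ⬝ᵥ (Matrix.of fun i j =>
        g.inner p (tangentStdBasis p i) (tangentStdBasis p j)).mulVec x := by
      have e' : g.inner p v v = g.inner p (∑ i, x i • tangentStdBasis p i)
        (∑ i, x i • tangentStdBasis p i) := rfl
      rw [e', map_sum, map_sum, dotProduct]
      simp only [_root_.sum_apply, map_smul, smul_eq_mul, _root_.smul_apply, Matrix.mulVec,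
        dotProduct, Matrix.of_apply, Finset.mul_sum, Pi.star_apply, star_trivial]
      rw [Finset.sum_comm]
      refine Finset.sum_congr rfl fun i _ => Finset.sum_congr rfl fun j _ => ?_
      ring
    exact this.trans_eq e

/-- Separates a coordinate determinant, multiplicative under composition, from metric factors at the
two endpoints, which cancel in chart computations. -/
theorem absDet_eq_abs_tangentDet (g : ContinuousRiemannianMetric (EuclideanSpace ℝ (Fin n))
      (fun p : M => TangentSpace (𝓡 n) p)) {p q : M}
    (L : TangentSpace (𝓡 n) p →L[ℝ] TangentSpace (𝓡 n) q) :
    absDet g L = |tangentDet L| * √(gramDet g q (fun i => tangentStdBasis q i)) /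
      √(gramDet g p (fun i => tangentStdBasis p i)) := by
  have : gramDet g q (fun i => L (tangentStdBasis p i)) =
      tangentDet L ^ 2 * gramDet g q (fun i => tangentStdBasis q i) :=
    gramDet_linearMap g q L
  rw [absDet, this, Real.sqrt_div' _ (gramDet_tangentStdBasis_pos g p).le,
    Real.sqrt_mul (sq_nonneg _), Real.sqrt_sq_eq_abs]

theorem volumeDensity_eq_abs_tangentDet (g : ContinuousRiemannianMetric (EuclideanSpace ℝ (Fin n))
      (fun p : M => TangentSpace (𝓡 n) p)) (x₀ : M) (y : EuclideanSpace ℝ (Fin n)) :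
    volumeDensity g x₀ y =
      |tangentDet (mfderiv (𝓡 n) (𝓡 n) (chartAt (EuclideanSpace ℝ (Fin n)) x₀).symm y)| *
        √(gramDet g ((chartAt (EuclideanSpace ℝ (Fin n)) x₀).symm y)
          (fun i => tangentStdBasis _ i)) := by
  have : gramDet g ((chartAt (EuclideanSpace ℝ (Fin n)) x₀).symm y) (fun i =>
      mfderiv (𝓡 n) (𝓡 n) (chartAt (EuclideanSpace ℝ (Fin n)) x₀).symm y (tangentStdBasis y i)) =
      tangentDet (mfderiv (𝓡 n) (𝓡 n) (chartAt (EuclideanSpace ℝ (Fin n)) x₀).symm y) ^ 2 *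
      gramDet g ((chartAt (EuclideanSpace ℝ (Fin n)) x₀).symm y)
          (fun i => tangentStdBasis _ i) :=
    gramDet_linearMap g _ _
  rw [volumeDensity, this, Real.sqrt_mul (sq_nonneg _), Real.sqrt_sq_eq_abs]

theorem absDet_id (g : ContinuousRiemannianMetric (EuclideanSpace ℝ (Fin n))
      (fun p : M => TangentSpace (𝓡 n) p)) (p : M) :
    absDet g (ContinuousLinearMap.id ℝ (TangentSpace (𝓡 n) p)) = 1 := by
  rw [absDet]
  simp only [ContinuousLinearMap.id_apply]
  rw [div_self (gramDet_tangentStdBasis_pos g p).ne', Real.sqrt_one]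

/-- A map between manifolds, differentiable at a point, is differentiable in charts, and its
derivative in charts is compatible with `absDet` and with the volume densities. -/
theorem MDifferentiableAt.exists_hasFDerivAt_chart
    (g : ContinuousRiemannianMetric (EuclideanSpace ℝ (Fin n))
      (fun p : M => TangentSpace (𝓡 n) p)) {F : M → M} {x₀ x₁ : M} {y : EuclideanSpace ℝ (Fin n)}
    (hy : y ∈ (chartAt (EuclideanSpace ℝ (Fin n)) x₀).target)
    (hF : MDifferentiableAt (𝓡 n) (𝓡 n) F ((chartAt (EuclideanSpace ℝ (Fin n)) x₀).symm y))
    (hFy : F ((chartAt (EuclideanSpace ℝ (Fin n)) x₀).symm y) ∈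
      (chartAt (EuclideanSpace ℝ (Fin n)) x₁).source) :
    ∃ L : EuclideanSpace ℝ (Fin n) →L[ℝ] EuclideanSpace ℝ (Fin n),
      HasFDerivAt (chartAt (EuclideanSpace ℝ (Fin n)) x₁ ∘ F ∘
        (chartAt (EuclideanSpace ℝ (Fin n)) x₀).symm) L y ∧
      |L.det| * volumeDensity g x₁ (chartAt (EuclideanSpace ℝ (Fin n)) x₁
        (F ((chartAt (EuclideanSpace ℝ (Fin n)) x₀).symm y))) =
      absDet g (mfderiv (𝓡 n) (𝓡 n) F ((chartAt (EuclideanSpace ℝ (Fin n)) x₀).symm y)) *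
        volumeDensity g x₀ y := by
  set φ := chartAt (EuclideanSpace ℝ (Fin n)) x₀ with hφ
  set ψ := chartAt (EuclideanSpace ℝ (Fin n)) x₁ with hψ
  have mφ : φ.MDifferentiable (𝓡 n) (𝓡 n) := mdifferentiable_chart x₀
  have mψ : ψ.MDifferentiable (𝓡 n) (𝓡 n) := mdifferentiable_chart x₁
  have h1 := (mφ.mdifferentiableAt_symm hy).hasMFDerivAt
  have h2 := hF.hasMFDerivAt
  have h3 := (mψ.mdifferentiableAt hFy).hasMFDerivAt
  have h4 := HasMFDerivAt.comp y h3 (HasMFDerivAt.comp y h2 h1)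
  refine ⟨_, hasMFDerivAt_iff_hasFDerivAt.1 h4, ?_⟩
  set A0 := mfderiv (𝓡 n) (𝓡 n) φ.symm y with hA0
  set A1 := mfderiv (𝓡 n) (𝓡 n) F (φ.symm y) with hA1
  set A2 := mfderiv (𝓡 n) (𝓡 n) ψ (F (φ.symm y)) with hA2
  set A3 := mfderiv (𝓡 n) (𝓡 n) ψ.symm (ψ (F (φ.symm y))) with hA3
  have e1 : ContinuousLinearMap.det (R := ℝ) (M := EuclideanSpace ℝ (Fin n)) (A2 ∘L A1 ∘L A0) =
      tangentDet A2 * (tangentDet A1 * tangentDet A0) := by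
    refine (ContinuousLinearMap.det_comp (V := EuclideanSpace ℝ (Fin n)) A2 (A1 ∘L A0)).trans ?_
    exact congrArg (fun d => tangentDet A2 * d)
      (ContinuousLinearMap.det_comp (V := EuclideanSpace ℝ (Fin n)) A1 A0)
  -- The density at the image point contains the Jacobian of `ψ.symm`, which cancels that of `ψ`.
  have e2 : tangentDet A3 * tangentDet A2 = 1 := by
    have := mψ.symm_comp_deriv hFy
    have h := congrArg (ContinuousLinearMap.det (R := ℝ) (M := EuclideanSpace ℝ (Fin n))) this
    have h' := (ContinuousLinearMap.det_comp (V := EuclideanSpace ℝ (Fin n)) A3 A2)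
    exact h'.symm.trans (h.trans LinearMap.det_id)
  have e3 : |tangentDet A3| * |tangentDet A2| = 1 := by rw [← abs_mul, e2, abs_one]
  rw [volumeDensity_eq_abs_tangentDet, volumeDensity_eq_abs_tangentDet, absDet_eq_abs_tangentDet]
  rw [← hφ, ← hψ, ← hA3, ← hA0, ψ.left_inv hFy]
  set G0 := √(gramDet g (φ.symm y) fun i => tangentStdBasis _ i) with hG0
  set G1 := √(gramDet g (F (φ.symm y)) fun i => tangentStdBasis _ i) with hG1
  have hG0p : 0 < G0 := Real.sqrt_pos.2 (gramDet_tangentStdBasis_pos g _)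
  refine (congrArg (fun d => |d| * (|tangentDet A3| * G1)) e1).trans ?_
  rw [abs_mul, abs_mul]
  calc _ = (|tangentDet A3| * |tangentDet A2|) * (|tangentDet A1| * |tangentDet A0| * G1) := by
        ring
    _ = _ := by rw [e3]; field_simp

/-- The volume density is continuous at the center of the chart. -/
theorem continuousAt_volumeDensity (g : ContinuousRiemannianMetric (EuclideanSpace ℝ (Fin n))
      (fun p : M => TangentSpace (𝓡 n) p)) (x₀ : M) :
    ContinuousAt (volumeDensity g x₀) (chartAt (EuclideanSpace ℝ (Fin n)) x₀ x₀) := by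
  set φ := chartAt (EuclideanSpace ℝ (Fin n)) x₀ with hφ
  have hx₀ : x₀ ∈ φ.source := mem_chart_source _ x₀
  have ht : φ.target ∈ 𝓝 (φ x₀) := φ.open_target.mem_nhds (φ.map_source hx₀)
  have hs : ContinuousAt φ.symm (φ x₀) := φ.symm.continuousAt (φ.map_source hx₀)
  have hv : ∀ i, ContinuousAt (fun y => (⟨φ.symm y, mfderiv (𝓡 n) (𝓡 n) φ.symm y
      (tangentStdBasis y i)⟩ : TotalSpace (EuclideanSpace ℝ (Fin n))
        (fun p : M => TangentSpace (𝓡 n) p))) (φ x₀) := by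
    intro i
    rw [FiberBundle.continuousAt_totalSpace]
    refine ⟨hs, ?_⟩
    -- The trivialization at `x₀` acts on fibers as the derivative of `φ`, so the coordinate fields
    -- of this chart are constant in it.
    refine (continuousAt_const (y := EuclideanSpace.basisFun (Fin n) ℝ i)).congr ?_
    filter_upwards [ht] with y hy
    have hys := φ.map_target hy
    have h1 := TangentBundle.continuousLinearMapAt_trivializationAt (I := 𝓡 n) hys
    simp only [extChartAt, OpenPartialHomeomorph.extend, mfld_simps] at h1
    have h2 := congrArg (fun L : EuclideanSpace ℝ (Fin n) →L[ℝ] EuclideanSpace ℝ (Fin n) =>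
      L (EuclideanSpace.basisFun (Fin n) ℝ i))
      ((mdifferentiable_chart (I := 𝓡 n) x₀).comp_symm_deriv hy)
    have h3 := congrArg (fun L : TangentSpace (𝓡 n) (φ.symm y) →L[ℝ] EuclideanSpace ℝ (Fin n) =>
      L (mfderiv (𝓡 n) (𝓡 n) φ.symm y (tangentStdBasis y i))) h1
    have hb : φ.symm y ∈ (trivializationAt (EuclideanSpace ℝ (Fin n))
      (TangentSpace (𝓡 n)) x₀).baseSet := by
      simpa using hys
    rw [φ.left_inv hx₀]
    rw [Trivialization.continuousLinearMapAt_apply, Trivialization.coe_linearMapAt_of_mem _ hb] at h3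
    have hbi : tangentStdBasis y i = EuclideanSpace.basisFun (Fin n) ℝ i := by
      rw [← OrthonormalBasis.coe_toBasis]
      rfl
    refine Eq.trans ?_ h3.symm
    refine Eq.trans h2.symm ?_
    rw [hbi]
    rfl
  have hentry : ∀ i j, ContinuousAt (fun y => g.inner (φ.symm y)
      (mfderiv (𝓡 n) (𝓡 n) φ.symm y (tangentStdBasis y i))
      (mfderiv (𝓡 n) (𝓡 n) φ.symm y (tangentStdBasis y j))) (φ x₀) := by
    intro i j
    have hg := ContinuousAt.comp (f := φ.symm) (x := φ x₀) g.continuous.continuousAt hs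
    have := ContinuousAt.clm_bundle_apply₂ (F₁ := EuclideanSpace ℝ (Fin n))
      (F₂ := EuclideanSpace ℝ (Fin n)) (F₃ := ℝ) (E₃ := Bundle.Trivial M ℝ)
      (ψ := fun y => g.inner (φ.symm y)) hg (hv i) (hv j)
    rw [FiberBundle.continuousAt_totalSpace] at this
    exact this.2
  unfold volumeDensity gramDet
  refine Real.continuous_sqrt.continuousAt.comp ?_
  have hc : Continuous (Matrix.det : Matrix (Fin n) (Fin n) ℝ → ℝ) :=
    continuous_id.matrix_det
  refine hc.continuousAt.comp ?_
  exact continuousAt_pi.2 fun i => continuousAt_pi.2 fun j => hentry i j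

theorem volumeDensity_pos (g : ContinuousRiemannianMetric (EuclideanSpace ℝ (Fin n))
      (fun p : M => TangentSpace (𝓡 n) p)) (x₀ : M) {y : EuclideanSpace ℝ (Fin n)}
    (hy : y ∈ (chartAt (EuclideanSpace ℝ (Fin n)) x₀).target) : 0 < volumeDensity g x₀ y := by
  set φ := chartAt (EuclideanSpace ℝ (Fin n)) x₀ with hφ
  have mφ : φ.MDifferentiable (𝓡 n) (𝓡 n) := mdifferentiable_chart x₀
  rw [volumeDensity_eq_abs_tangentDet]
  refine mul_pos (abs_pos.2 ?_) (Real.sqrt_pos.2 (gramDet_tangentStdBasis_pos g _))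
  have h := congrArg (ContinuousLinearMap.det (R := ℝ) (M := EuclideanSpace ℝ (Fin n)))
    (mφ.comp_symm_deriv hy)
  have h' := ContinuousLinearMap.det_comp (V := EuclideanSpace ℝ (Fin n))
    (mfderiv (𝓡 n) (𝓡 n) φ (φ.symm y)) (mfderiv (𝓡 n) (𝓡 n) φ.symm y)
  have h'' := h'.symm.trans (h.trans LinearMap.det_id)
  exact right_ne_zero_of_mul (h''.trans_ne one_ne_zero)

end Riemannian

/-! ### Riemannian volume and its expansion -/

section Volume

variable {n : ℕ} {M : Type*} [TopologicalSpace M] [ChartedSpace (EuclideanSpace ℝ (Fin n)) M]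

theorem OpenPartialHomeomorph.measurableSet_image {X Y : Type*} [TopologicalSpace X]
    [MeasurableSpace X] [BorelSpace X] [TopologicalSpace Y] [MeasurableSpace Y] [BorelSpace Y]
    (φ : OpenPartialHomeomorph X Y) {A : Set X} (hA : MeasurableSet A) (hAs : A ⊆ φ.source) :
    MeasurableSet (φ '' A) := by
  have him : φ '' A = φ.target ∩ φ.symm ⁻¹' A := by
    rw [← φ.image_source_inter_eq' A, inter_eq_right.2 hAs]
  rw [him, ← Subtype.image_preimage_coe]
  have h : Measurable (φ.target.domRestrict φ.symm) :=
    (continuousOn_iff_continuous_domRestrict.1 φ.symm.continuousOn).measurable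
  exact φ.open_target.measurableSet.subtype_image (h hA)

variable [IsManifold (𝓡 n) 1 M] [MeasurableSpace M]
  (g : ContinuousRiemannianMetric (EuclideanSpace ℝ (Fin n))
      (fun p : M => TangentSpace (𝓡 n) p))

theorem chartVolume_le_riemannianVolume (x₀ : M) : chartVolume g x₀ ≤ riemannianVolume g :=
  le_iSup (fun x => chartVolume g x) x₀

variable [BorelSpace M]

/-- An injective differentiable map between chart domains whose Jacobian is at least `c`
multiplies volumes by at least `c`. -/
theorem ofReal_mul_chartVolume_le {F : M → M} {x₀ x₁ : M} {B : Set M} (hB : MeasurableSet B)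
    (hB₀ : B ⊆ (chartAt (EuclideanSpace ℝ (Fin n)) x₀).source)
    (hB₁ : MapsTo F B (chartAt (EuclideanSpace ℝ (Fin n)) x₁).source) (hinj : InjOn F B)
    (hF : ∀ p ∈ B, MDifferentiableAt (𝓡 n) (𝓡 n) F p) {c : ℝ}
    (hc : ∀ p ∈ B, c ≤ absDet g (mfderiv (𝓡 n) (𝓡 n) F p)) :
    MeasurableSet (F '' B) ∧
      ENNReal.ofReal c * chartVolume g x₀ B ≤ chartVolume g x₁ (F '' B) := by
  set φ := chartAt (EuclideanSpace ℝ (Fin n)) x₀ with hφ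
  set ψ := chartAt (EuclideanSpace ℝ (Fin n)) x₁ with hψ
  set G : EuclideanSpace ℝ (Fin n) → EuclideanSpace ℝ (Fin n) := ψ ∘ F ∘ φ.symm with hG
  have hmem : ∀ y ∈ φ '' B, y ∈ φ.target ∧ φ.symm y ∈ B := by
    rintro _ ⟨p, hp, rfl⟩
    exact ⟨φ.map_source (hB₀ hp), by rwa [φ.left_inv (hB₀ hp)]⟩
  have hex : ∀ y, ∃ L : EuclideanSpace ℝ (Fin n) →L[ℝ] EuclideanSpace ℝ (Fin n),
      y ∈ φ '' B → HasFDerivAt G L y ∧ |L.det| * volumeDensity g x₁ (G y) =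
      absDet g (mfderiv (𝓡 n) (𝓡 n) F (φ.symm y)) * volumeDensity g x₀ y := by
    intro y
    by_cases hy : y ∈ φ '' B
    · obtain ⟨L, hL⟩ := MDifferentiableAt.exists_hasFDerivAt_chart g (hmem y hy).1
        (hF _ (hmem y hy).2) (hB₁ (hmem y hy).2)
      exact ⟨L, fun _ => hL⟩
    · exact ⟨0, fun h => absurd h hy⟩
  choose G' hG' using hex
  have hd : ∀ y ∈ φ '' B, HasFDerivWithinAt G (G' y) (φ '' B) y := fun y hy =>
    (hG' y hy).1.hasFDerivWithinAt
  have hmeas := φ.measurableSet_image hB hB₀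
  have hGφ : ∀ p ∈ B, G (φ p) = ψ (F p) := by
    intro p hp
    simp [G, φ.left_inv (hB₀ hp)]
  have hGinj : InjOn G (φ '' B) := by
    rintro _ ⟨p, hp, rfl⟩ _ ⟨q, hq, rfl⟩ h
    rw [hGφ p hp, hGφ q hq] at h
    rw [hinj hp hq (ψ.injOn (hB₁ hp) (hB₁ hq) h)]
  have himg : G '' (φ '' B) = ψ '' (F '' B) := by
    rw [image_image, image_image]
    exact image_congr hGφ
  have hFB : F '' B ⊆ ψ.source := hB₁.image_subset
  have hmF : MeasurableSet (F '' B) := by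
    have h1 := measurable_image_of_fderivWithin hmeas hd hGinj
    have h2 := ψ.symm.measurableSet_image h1 (by
      rw [himg]; exact (image_mono hFB).trans ψ.image_source_eq_target.subset)
    rwa [himg, image_image, image_congr (fun q hq => ψ.left_inv (hFB hq)), image_id'] at h2
  refine ⟨hmF, ?_⟩
  rw [chartVolume_apply g x₀ hB, chartVolume_apply g x₁ hmF, inter_eq_left.2 hB₀,
    inter_eq_left.2 hFB, ← hψ, ← himg,
    lintegral_image_eq_lintegral_abs_det_fderiv_mul volume hmeas hd hGinj]
  -- This direction of pulling out the constant needs no measurability of the density.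
  refine (lintegral_const_mul_le _ _).trans (setLIntegral_mono' hmeas fun y hy => ?_)
  have hv : 0 ≤ volumeDensity g x₀ y := Real.sqrt_nonneg _
  rw [← ENNReal.ofReal_mul (abs_nonneg _), (hG' y hy).2, ← ENNReal.ofReal_mul' hv]
  exact ENNReal.ofReal_le_ofReal (mul_le_mul_of_nonneg_right (hc _ (hmem y hy).2) hv)

/-- The identity is injective with Jacobian `1`, and the chart at `x₀` sees only the part of `A` in
its domain. Exchanging the charts gives equality on overlaps. -/
theorem chartVolume_le_chartVolume {x₀ x₁ : M} {A : Set M} (hA : MeasurableSet A)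
    (hA₁ : A ⊆ (chartAt (EuclideanSpace ℝ (Fin n)) x₁).source) :
    chartVolume g x₀ A ≤ chartVolume g x₁ A := by
  set φ := chartAt (EuclideanSpace ℝ (Fin n)) x₀ with hφ
  have hm : MeasurableSet (A ∩ φ.source) := hA.inter φ.open_source.measurableSet
  have h1 : chartVolume g x₀ A = chartVolume g x₀ (A ∩ φ.source) := by
    rw [chartVolume_apply g x₀ hA, chartVolume_apply g x₀ hm, inter_assoc, inter_self]
  have h2 := (ofReal_mul_chartVolume_le g (F := id) (c := 1) (x₀ := x₀) (x₁ := x₁) hm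
    inter_subset_right (fun p hp => hA₁ hp.1) (injOn_id _) (fun p _ => mdifferentiableAt_id)
    (fun p _ => by rw [mfderiv_id, absDet_id])).2
  rw [ENNReal.ofReal_one, one_mul, image_id] at h2
  rw [h1]
  exact h2.trans (measure_mono inter_subset_left)

theorem riemannianVolume_eq_chartVolume {x₀ : M} {A : Set M} (hA : MeasurableSet A)
    (hA₀ : A ⊆ (chartAt (EuclideanSpace ℝ (Fin n)) x₀).source) :
    riemannianVolume g A = chartVolume g x₀ A := by
  refine le_antisymm ?_ (chartVolume_le_riemannianVolume g x₀ A)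
  -- A supremum of measures is not computed set by set, so a single measure dominating every chart
  -- volume is exhibited, whose value at `A` is the chart volume.
  have h : riemannianVolume g ≤ (chartVolume g x₀).restrict A + (riemannianVolume g).restrict Aᶜ := by
    refine iSup_le fun x => Measure.le_iff.2 fun s hs => ?_
    rw [Measure.add_apply, Measure.restrict_apply hs, Measure.restrict_apply hs,
      ← measure_inter_add_sdiff s hA]
    exact add_le_add (chartVolume_le_chartVolume g (hs.inter hA) (inter_subset_right.trans hA₀))
      (chartVolume_le_riemannianVolume g x _)
  refine (h A).trans ?_
  simp [Measure.restrict_apply hA]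

/-- An injective differentiable map whose Jacobian is at least `c` multiplies volumes by at
least `c`. -/
theorem ofReal_mul_riemannianVolume_le [CompactSpace M] {F : M → M}
    (hF : MDifferentiable (𝓡 n) (𝓡 n) F) {A : Set M} (hA : MeasurableSet A) (hinj : InjOn F A)
    {c : ℝ} (hc : ∀ p ∈ A, c ≤ absDet g (mfderiv (𝓡 n) (𝓡 n) F p)) :
    ENNReal.ofReal c * riemannianVolume g A ≤ riemannianVolume g (F '' A) := by
  let S : M → Set M := fun x => (chartAt (EuclideanSpace ℝ (Fin n)) x).source
  have hS : ∀ x, IsOpen (S x) := fun x => (chartAt (EuclideanSpace ℝ (Fin n)) x).open_source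
  rcases A.eq_empty_or_nonempty with rfl | ⟨a, -⟩
  · simp
  obtain ⟨t, ht⟩ := isCompact_univ.elim_finite_subcover S hS
    (fun x _ => mem_iUnion.2 ⟨x, mem_chart_source _ x⟩)
  have htne : Nonempty t := by
    obtain ⟨x, hx, -⟩ := mem_iUnion₂.1 (ht (mem_univ a))
    exact ⟨⟨x, hx⟩⟩
  -- Enumerates pairs of a source chart and a target chart. Repetitions are harmless, since the
  -- pieces are made disjoint afterwards.
  obtain ⟨u, hu⟩ := exists_surjective_nat (t × t)
  let W : ℕ → Set M := fun k => S (u k).1 ∩ F ⁻¹' S (u k).2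
  have hWm : ∀ k, MeasurableSet (W k) := fun k =>
    ((hS _).inter ((hS _).preimage hF.continuous)).measurableSet
  have hWu : ⋃ k, W k = univ := by
    refine eq_univ_of_forall fun x => mem_iUnion.2 ?_
    obtain ⟨i, hi, hxi⟩ := mem_iUnion₂.1 (ht (mem_univ x))
    obtain ⟨j, hj, hxj⟩ := mem_iUnion₂.1 (ht (mem_univ (F x)))
    obtain ⟨k, hk⟩ := hu (⟨i, hi⟩, ⟨j, hj⟩)
    refine ⟨k, ?_⟩
    simp only [W, hk]
    exact ⟨hxi, hxj⟩
  let B : ℕ → Set M := fun k => A ∩ disjointed W k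
  have hBA : ⋃ k, B k = A := by
    rw [← inter_iUnion, iUnion_disjointed, hWu, inter_univ]
  have hBm : ∀ k, MeasurableSet (B k) := fun k => hA.inter (.disjointed hWm k)
  have hBd : Pairwise (Function.onFun Disjoint B) := fun i j hij =>
    (disjoint_disjointed W hij).mono inter_subset_right inter_subset_right
  have hBW : ∀ k, B k ⊆ W k := fun k => inter_subset_right.trans (disjointed_subset W k)
  have hk := fun k => ofReal_mul_chartVolume_le g (F := F) (c := c) (x₀ := (u k).1)
    (x₁ := (u k).2) (hBm k) (fun p hp => (hBW k hp).1) (fun p hp => (hBW k hp).2)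
    (hinj.mono inter_subset_left) (fun p _ => hF p) (fun p hp => hc p hp.1)
  have hFd : Pairwise (Function.onFun Disjoint fun k => F '' B k) := by
    refine fun i j hij => disjoint_left.2 ?_
    rintro _ ⟨p, hp, rfl⟩ ⟨q, hq, hqp⟩
    exact (hBd hij).ne_of_mem hp hq (hinj hp.1 hq.1 hqp.symm)
  calc ENNReal.ofReal c * riemannianVolume g A
      = ∑' k, ENNReal.ofReal c * riemannianVolume g (B k) := by
        rw [ENNReal.tsum_mul_left, ← measure_iUnion hBd hBm, hBA]
    _ ≤ ∑' k, riemannianVolume g (F '' B k) := by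
        refine ENNReal.tsum_le_tsum fun k => ?_
        rw [riemannianVolume_eq_chartVolume g (hBm k) fun p hp => (hBW k hp).1]
        exact (hk k).2.trans (chartVolume_le_riemannianVolume g _ _)
    _ = riemannianVolume g (F '' A) := by
        rw [← measure_iUnion hFd fun k => (hk k).1, ← image_iUnion, hBA]

theorem riemannianVolume_univ_pos [Nonempty M] : 0 < riemannianVolume g univ := by
  obtain ⟨x₀⟩ := ‹Nonempty M›
  set φ := chartAt (EuclideanSpace ℝ (Fin n)) x₀ with hφ
  have hx₀ := φ.map_source (mem_chart_source (EuclideanSpace ℝ (Fin n)) x₀)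
  have hpos := volumeDensity_pos g x₀ hx₀
  set ε := volumeDensity g x₀ (φ x₀) / 2 with hε
  have hnb : ∀ᶠ y in 𝓝 (φ x₀), y ∈ φ.target ∧ ε < volumeDensity g x₀ y :=
    inter_mem (φ.open_target.mem_nhds hx₀)
      ((continuousAt_volumeDensity g x₀).eventually_const_lt (half_lt_self hpos))
  obtain ⟨O, hO, hOo, hxO⟩ := mem_nhds_iff.1 hnb
  refine lt_of_lt_of_le ?_ (chartVolume_le_riemannianVolume g x₀ univ)
  rw [chartVolume_apply g x₀ MeasurableSet.univ, univ_inter, ← hφ, φ.image_source_eq_target]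
  calc 0 < ENNReal.ofReal ε * volume O :=
        ENNReal.mul_pos (ENNReal.ofReal_pos.2 (half_pos hpos)).ne'
          (hOo.measure_pos volume ⟨_, hxO⟩).ne'
    _ = ∫⁻ _ in O, ENNReal.ofReal ε := by simp
    _ ≤ ∫⁻ y in O, ENNReal.ofReal (volumeDensity g x₀ y) :=
        setLIntegral_mono' hOo.measurableSet fun y hy => ENNReal.ofReal_le_ofReal (hO hy).2.le
    _ ≤ _ := lintegral_mono_set fun y hy => (hO hy).1

/-- Every point is the center of its own chart, so continuity of the density at centers already
makes the volume locally finite; compactness concludes. -/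
theorem riemannianVolume_univ_lt_top [CompactSpace M] : riemannianVolume g univ < ⊤ := by
  refine isCompact_univ.measure_lt_top_of_nhdsWithin fun x₀ _ => ?_
  rw [nhdsWithin_univ]
  set φ := chartAt (EuclideanSpace ℝ (Fin n)) x₀ with hφ
  have hs := mem_chart_source (EuclideanSpace ℝ (Fin n)) x₀
  set C := volumeDensity g x₀ (φ x₀) + 1 with hC
  have hnb : ∀ᶠ y in 𝓝 (φ x₀), y ∈ Metric.ball (φ x₀) 1 ∧ volumeDensity g x₀ y < C :=
    inter_mem (Metric.ball_mem_nhds _ one_pos)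
      ((continuousAt_volumeDensity g x₀).eventually_lt_const (lt_add_one _))
  obtain ⟨U, hU, hUo, hxU⟩ := mem_nhds_iff.1
    (((φ.continuousAt hs).eventually hnb).and (φ.open_source.mem_nhds hs))
  refine ⟨U, hUo.mem_nhds hxU, ?_⟩
  have hUs : U ⊆ φ.source := fun p hp => (hU hp).2
  rw [riemannianVolume_eq_chartVolume g hUo.measurableSet hUs,
    chartVolume_apply g x₀ hUo.measurableSet, ← hφ, inter_eq_left.2 hUs]
  calc ∫⁻ y in φ '' U, ENNReal.ofReal (volumeDensity g x₀ y)
      ≤ ∫⁻ _ in φ '' U, ENNReal.ofReal C := by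
        refine setLIntegral_mono' (φ.measurableSet_image hUo.measurableSet hUs) ?_
        rintro _ ⟨p, hp, rfl⟩
        exact ENNReal.ofReal_le_ofReal (hU hp).1.2.le
    _ = ENNReal.ofReal C * volume (φ '' U) := by simp
    _ ≤ ENNReal.ofReal C * volume (Metric.ball (φ x₀) 1) := by
        gcongr
        rintro _ ⟨p, hp, rfl⟩
        exact (hU hp).1.1
    _ < ⊤ := ENNReal.mul_lt_top ENNReal.ofReal_lt_top measure_ball_lt_top

theorem isProbabilityMeasure_lebesgueMeasure [CompactSpace M] [Nonempty M] :
    IsProbabilityMeasure (lebesgueMeasure g) := by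
  refine ⟨?_⟩
  rw [lebesgueMeasure, Measure.smul_apply, smul_eq_mul]
  exact ENNReal.inv_mul_cancel (riemannianVolume_univ_pos g).ne'
    (riemannianVolume_univ_lt_top g).ne

end Volume

/-! ### Uniform local injectivity and forward tubes -/

section Expansive

variable {n : ℕ} {M : Type*}

/-- A differentiable map of a manifold with nonvanishing Jacobian is locally injective. -/
theorem MDifferentiable.exists_nhds_injOn_of_absDet_pos [TopologicalSpace M]
    [ChartedSpace (EuclideanSpace ℝ (Fin n)) M] [IsManifold (𝓡 n) 1 M]
    (g : ContinuousRiemannianMetric (EuclideanSpace ℝ (Fin n))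
      (fun p : M => TangentSpace (𝓡 n) p)) {f : M → M} (hf : MDifferentiable (𝓡 n) (𝓡 n) f)
    (hdet : ∀ x, 0 < absDet g (mfderiv (𝓡 n) (𝓡 n) f x)) (x : M) : ∃ U ∈ 𝓝 x, InjOn f U := by
  set φ := chartAt (EuclideanSpace ℝ (Fin n)) x with hφ
  set ψ := chartAt (EuclideanSpace ℝ (Fin n)) (f x) with hψ
  have hx : x ∈ φ.source := mem_chart_source _ x
  have hfx : f x ∈ ψ.source := mem_chart_source _ (f x)
  let Ω := φ.target ∩ φ.symm ⁻¹' (f ⁻¹' ψ.source)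
  have hΩ : IsOpen Ω := φ.isOpen_inter_preimage_symm (ψ.open_source.preimage hf.continuous)
  have hex : ∀ y, ∃ L : EuclideanSpace ℝ (Fin n) ≃L[ℝ] EuclideanSpace ℝ (Fin n),
      y ∈ Ω → HasFDerivAt (ψ ∘ f ∘ φ.symm)
        (L : EuclideanSpace ℝ (Fin n) →L[ℝ] EuclideanSpace ℝ (Fin n)) y := by
    intro y
    by_cases hy : y ∈ Ω
    · obtain ⟨L, hL, hLd⟩ := MDifferentiableAt.exists_hasFDerivAt_chart g hy.1 (hf _) hy.2
      -- In the compatibility identity the right side is a product of positive factors, so the left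
      -- side cannot vanish.
      have hne : L.det ≠ 0 := by
        intro h0
        rw [h0, abs_zero, zero_mul] at hLd
        exact (mul_pos (hdet _) (volumeDensity_pos g x hy.1)).ne hLd
      exact ⟨L.toContinuousLinearEquivOfDetNeZero hne, fun _ => by simpa using hL⟩
    · exact ⟨.refl ℝ _, fun h => absurd h hy⟩
  choose L hL using hex
  have hφx : φ x ∈ Ω := ⟨φ.map_source hx, by simpa [φ.left_inv hx] using hfx⟩
  obtain ⟨U, hU, hinj⟩ := exists_nhds_injOn_of_hasFDerivAt hΩ hL hφx
  refine ⟨φ ⁻¹' U ∩ (φ.source ∩ f ⁻¹' ψ.source), inter_mem ((φ.continuousAt hx) hU)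
    ((φ.open_source.inter (ψ.open_source.preimage hf.continuous)).mem_nhds ⟨hx, hfx⟩), ?_⟩
  rintro p ⟨hpU, hp, hfp⟩ q ⟨hqU, hq, hfq⟩ hpq
  refine φ.injOn hp hq (hinj hpU hqU ?_)
  simp [φ.left_inv hp, φ.left_inv hq, hpq]

/-- A locally injective map of a compact metric space is injective at a uniform scale. -/
theorem exists_pos_forall_dist_le_of_locally_injective {X Y : Type*} [MetricSpace X]
    [CompactSpace X] {f : X → Y} (hf : ∀ x, ∃ U ∈ 𝓝 x, InjOn f U) :
    ∃ δ > (0 : ℝ), ∀ x y z, dist x y ≤ δ → dist x z ≤ δ → f y = f z → y = z := by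
  choose U hU hinj using hf
  obtain ⟨δ, hδ, h⟩ := lebesgue_number_lemma_of_metric (s := univ) (c := fun x => interior (U x))
    isCompact_univ (fun _ => isOpen_interior)
    (fun x _ => mem_iUnion.2 ⟨x, mem_interior_iff_mem_nhds.2 (hU x)⟩)
  refine ⟨δ / 2, half_pos hδ, fun x y z hy hz => ?_⟩
  obtain ⟨i, hi⟩ := h x (mem_univ x)
  have hsub : ∀ w, dist x w ≤ δ / 2 → w ∈ U i := fun w hw =>
    interior_subset (hi (by rw [Metric.mem_ball, dist_comm]; linarith))
  exact hinj i (hsub y hy) (hsub z hz)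

theorem isClosed_forwardTube {X : Type*} [MetricSpace X] {f : X → X} (hf : Continuous f) (δ : ℝ)
    (x : X) : IsClosed (forwardTube f δ x) := by
  have : forwardTube f δ x = ⋂ i : ℕ, {y | dist (f^[i] x) (f^[i] y) ≤ δ} := by
    ext y
    simp [forwardTube]
  rw [this]
  exact isClosed_iInter fun i =>
    isClosed_le (continuous_const.dist (hf.iterate i)) continuous_const

/-- If `f` is injective at scale `δ`, then its iterates are injective on the `δ`-tubes. -/
theorem injOn_iterate_forwardTube {X : Type*} [MetricSpace X] {f : X → X} {δ : ℝ}
    (hδ : ∀ x y z, dist x y ≤ δ → dist x z ≤ δ → f y = f z → y = z) (x : X) (k : ℕ) :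
    InjOn f^[k] (forwardTube f δ x) := by
  induction k with
  | zero => exact injOn_id _
  | succ k ih =>
    intro y hy z hz hyz
    rw [Function.iterate_succ_apply', Function.iterate_succ_apply'] at hyz
    exact ih hy hz (hδ _ _ _ (hy k) (hz k) hyz)

theorem MDifferentiable.iterate [TopologicalSpace M]
    [ChartedSpace (EuclideanSpace ℝ (Fin n)) M] {f : M → M}
    (hf : MDifferentiable (𝓡 n) (𝓡 n) f) (k : ℕ) : MDifferentiable (𝓡 n) (𝓡 n) f^[k] := by
  induction k with
  | zero => exact mdifferentiable_id
  | succ k ih => exact ih.comp hf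

end Expansive

end

/-- Every volume expanding map of a closed manifold is positively Lebesgue-expansive. The distance
of `M` is any one that induces its topology, and `g` is any continuous Riemannian metric. -/
theorem mainTheorem12 {n : ℕ} {M : Type*} [MetricSpace M] [CompactSpace M] [ConnectedSpace M]
    [ChartedSpace (EuclideanSpace ℝ (Fin n)) M] [IsManifold (𝓡 n) 1 M]
    [MeasurableSpace M] [BorelSpace M]
    (g : Bundle.ContinuousRiemannianMetric (EuclideanSpace ℝ (Fin n))
      (fun p : M => TangentSpace (𝓡 n) p))
    (f : M → M) (hf : IsVolumeExpanding g f) :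
    IsPositivelyExpansive (lebesgueMeasure g) f := by
  obtain ⟨hd, K, hK, l, hl, hdet⟩ := hf
  refine ⟨isProbabilityMeasure_lebesgueMeasure g, hd.continuous, ?_⟩
  obtain ⟨δ, hδ, hinj⟩ := exists_pos_forall_dist_le_of_locally_injective
    -- The case `k = 1` of the hypothesis bounds the Jacobian of `f` below by `K * l > 0`.
    (hd.exists_nhds_injOn_of_absDet_pos g fun x => by
      have := hdet x 1
      rw [pow_one, Function.iterate_one] at this
      exact lt_of_lt_of_le (by positivity) this)
  refine ⟨δ, hδ, fun x => ?_⟩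
  set A := forwardTube f δ x with hA
  have hAm : MeasurableSet A := (isClosed_forwardTube hd.continuous δ x).measurableSet
  -- The tube is mapped injectively by `f^[k]`, so its expanded volume still fits into `M`.
  have hle : ∀ k : ℕ, ENNReal.ofReal (K * l ^ k) * riemannianVolume g A ≤
      riemannianVolume g univ := fun k =>
    (ofReal_mul_riemannianVolume_le g (hd.iterate k) hAm (injOn_iterate_forwardTube hinj x k)
      fun p _ => hdet p k).trans (measure_mono (subset_univ _))
  have hlim : Tendsto (fun k : ℕ => ENNReal.ofReal (K * l ^ k)) atTop (𝓝 ⊤) :=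
    ENNReal.tendsto_ofReal_nhds_top.2
      ((tendsto_pow_atTop_atTop_of_one_lt hl).const_mul_atTop hK)
  have hzero : riemannianVolume g A = 0 := by
    by_contra h0
    have h1 := ENNReal.Tendsto.mul_const (b := riemannianVolume g A) hlim (Or.inl ENNReal.top_ne_zero)
    rw [ENNReal.top_mul h0] at h1
    exact (riemannianVolume_univ_lt_top g).ne (top_le_iff.1 (le_of_tendsto' h1 hle))
  rw [lebesgueMeasure, Measure.smul_apply, hzero, smul_zero]
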